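/- For a positive integer $m$, a ring $R$ with identity is called almost $m$-torsion clean if every $r\in R$ can be written as $r=u+e$ with $u\in R$ a unit satisfying $u^m=1$ and $e\in R$ an idempotent; $R$ is called $m$-torsion clean if $m$ is the smallest positive integer for which $R$ is almost $m$-torsion clean. Let $n$ be a natural number and let $\mathbb{M}_n(\mathbb{F}_2)$ denote the ring of $n\times n$ matrices over the field $\mathbb{F}_2$ with two elements. Then there exists $m\in\{2,3,4\}$ such that $\mathbb{M}_n(\mathbb{F}_2)$ is almost $m$-torsion clean. In fact $m=4$ always works: every $A\in\mathbb{M}_n(\mathbb{F}_2)$ is the sum of an idempotent and a unit $U$ with $U^4=I_n$. Moreover, if $n=4+8k$ for some integer $k\ge 0$, then $\mathbb{M}_n(\mathbb{F}_2)$ is (exactly) $4$-torsion clean. -/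

import Mathlib

/-- Every element of `R` is the sum of a unit `u` with `u ^ n = 1` and an idempotent `e`,
where `n` is a positive integer. -/
def IsAlmostTorsionClean (R : Type*) [Ring R] (n : ℕ) : Prop :=
  0 < n ∧ ∀ r : R, ∃ (u : Rˣ) (e : R), u ^ n = 1 ∧ IsIdempotentElem e ∧ r = (u : R) + e

/-- `n` is the smallest positive integer for which `R` is almost `n`-torsion clean. -/
def IsTorsionClean (R : Type*) [Ring R] (n : ℕ) : Prop :=
  IsLeast {k : ℕ | IsAlmostTorsionClean R k} n

/-! In characteristic 2, a splitting A = E + N with E idempotent and N ^ 4 = 0 gives A = (1 + N) +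
(1 - E) and (1 + N) ^ 4 = 1 + N ^ 4 = 1. The structure theorem over 𝔽₂[X] reduces the splitting to
multiplication by the root in 𝔽₂[X]/(p), where a Newton-type basis makes the operator bidiagonal
except in its last column (`isIdempotentAddNilpotent_root`).

For n = 4 + 8k, exponents 2 and 3 are each refuted by an odd number of diagonal copies of a 4 × 4
companion matrix: by commutation for 2 (`ne_add_of_sq_eq_one`), by traces for 3
(`Matrix.ne_add_of_cube_eq_one`). -/

/-- The endomorphism `f` is the sum of an idempotent and an endomorphism whose fourth power is
zero. -/
def IsIdempotentAddNilpotent {M : Type*} [AddCommGroup M] (f : AddMonoid.End M) : Prop :=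
  ∃ E N : AddMonoid.End M, E * E = E ∧ N ^ 4 = 0 ∧ f = E + N

/-! ### Splitting a cyclic operator -/

/-- At indices in `P`, E takes the subdiagonal entry; elsewhere it takes the diagonal one. What
remains is a shift cut at every index of `P`. Gaps in `P` are short and n - 2 lies in `P`, so N ^ 3
kills every basis vector but the last, and N sends the last into the span of the others. -/
lemma isIdempotentAddNilpotent_of_basis {V : Type*} [AddCommGroup V] [Module (ZMod 2) V]
    (f : Module.End (ZMod 2) V) {n : ℕ} (hn : 0 < n) (v : ℕ → V)
    (b : Module.Basis (Fin n) (ZMod 2) V) (hb : ∀ i, b i = v i)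
    (P : ℕ → Prop) (d : ℕ → ZMod 2) (hP : ∀ i, P i → ¬ P (i + 1))
    (hP3 : ∀ i, P i ∨ P (i + 1) ∨ P (i + 2)) (hPlast : ∀ i, i + 2 = n → P i)
    (hPn : ¬ P (n - 1))
    (hd1 : ∀ i, P i → d (i + 1) = 1) (hd0 : ∀ i, P i → d i = 0)
    (hf : ∀ i, i + 1 < n → f (v i) = d i • v i + v (i + 1))
    (hfn : f (v (n - 1)) - d (n - 1) • v (n - 1) ∈
      Submodule.span (ZMod 2) (v '' Set.Iio (n - 1))) :
    IsIdempotentAddNilpotent (f.toAddMonoidHom : AddMonoid.End V) := by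
  classical
  have hdd : ∀ x : ZMod 2, x * x = x := by decide
  let E : Module.End (ZMod 2) V :=
    b.constr (ZMod 2) (fun i => if P i then v (i + 1) else d i • v i)
  have hE : ∀ i < n, E (v i) = if P i then v (i + 1) else d i • v i := by
    intro i hi
    have := b.constr_basis (ZMod 2) (fun i => if P i then v (i + 1) else d i • v i) ⟨i, hi⟩
    rwa [hb] at this
  have hPlt : ∀ i < n, P i → i + 1 < n := by
    intro i hi hPi
    by_contra h
    exact hPn (by rwa [show n - 1 = i by omega])
  have hEE : E * E = E := by
    refine b.ext fun i => ?_
    rw [hb, Module.End.mul_apply, hE i i.2]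
    by_cases h : P i
    · simp only [h, if_true]
      rw [hE _ (hPlt i i.2 h), if_neg (hP _ h), hd1 _ h, one_smul]
    · simp only [h, if_false]
      rw [map_smul, hE i i.2, if_neg h, smul_smul, hdd]
  let N := f - E
  have hN : ∀ i, i + 1 < n → N (v i) = if P i then 0 else v (i + 1) := by
    intro i hi
    simp only [N, LinearMap.sub_apply]
    rw [hf i hi, hE i (by omega)]
    split_ifs with h
    · simp [hd0 i h]
    · simp
  have hstep : ∀ i, i + 1 < n → ¬ P i → i + 1 + 1 < n := by
    intro i hi h
    by_contra h'
    exact h (hPlast i (by omega))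
  have hN3 : ∀ i, i + 1 < n → (N ^ 3) (v i) = 0 := by
    intro i hi
    have e : (N ^ 3) (v i) = N (N (N (v i))) := rfl
    rw [e, hN i hi]
    by_cases h0 : P i
    · simp [h0]
    have hi1 := hstep i hi h0
    rw [if_neg h0, hN _ hi1]
    by_cases h1 : P (i + 1)
    · simp [h1]
    have hi2 := hstep _ hi1 h1
    rw [if_neg h1, hN _ hi2, if_pos]
    rcases hP3 i with h | h | h
    · exact absurd h h0
    · exact absurd h h1
    · exact h
  have hNn : N (v (n - 1)) ∈ Submodule.span (ZMod 2) (v '' Set.Iio (n - 1)) := by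
    simp only [N, LinearMap.sub_apply]
    rwa [hE _ (by omega), if_neg hPn]
  have hN4 : N ^ 4 = 0 := by
    refine b.ext fun i => ?_
    rw [hb, LinearMap.zero_apply]
    by_cases hi : (i : ℕ) + 1 < n
    · rw [pow_succ', Module.End.mul_apply, hN3 i hi, map_zero]
    · have hi' : (i : ℕ) = n - 1 := by have := i.2; omega
      rw [hi', pow_succ, Module.End.mul_apply]
      have : Submodule.span (ZMod 2) (v '' Set.Iio (n - 1)) ≤ LinearMap.ker (N ^ 3) := by
        rw [Submodule.span_le]
        rintro _ ⟨j, hj, rfl⟩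
        exact hN3 j (by have : j < n - 1 := hj; omega)
      exact this hNn
  refine ⟨E.toAddMonoidHom, N.toAddMonoidHom, ?_, ?_, ?_⟩
  · ext x
    exact LinearMap.congr_fun hEE x
  · ext x
    exact LinearMap.congr_fun hN4 x
  · ext x
    exact (add_sub_cancel (E x) (f x)).symm

open Polynomial in
lemma Polynomial.mem_span_of_degree_lt {R : Type*} [Ring R] (q : ℕ → R[X])
    (hq : ∀ i, (q i).Monic) (hdeg : ∀ i, (q i).natDegree = i) (k : ℕ) (g : R[X])
    (hg : g.degree < k) : g ∈ Submodule.span R (q '' Set.Iio k) := by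
  nontriviality R
  induction k generalizing g with
  | zero =>
    have : g = 0 := by
      rw [← Polynomial.degree_eq_bot]
      simpa using hg
    simp [this]
  | succ k ih =>
    have h1 : g - g.coeff k • q k ∈ Submodule.span R (q '' Set.Iio k) := by
      apply ih
      rw [Polynomial.degree_lt_iff_coeff_zero] at hg ⊢
      intro m hm
      rcases hm.eq_or_lt with rfl | hm
      · have : (q k).coeff k = 1 := by
          have := hq k
          rwa [Polynomial.Monic, Polynomial.leadingCoeff, hdeg] at this
        simp [this]
      · have h2 : (q k).coeff m = 0 :=
          Polynomial.coeff_eq_zero_of_natDegree_lt (by rw [hdeg]; exact hm)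
        simp [h2, hg m (by exact_mod_cast hm)]
    have h2 := Submodule.span_mono (R := R)
      (Set.image_mono (f := q) (Set.Iio_subset_Iio (Nat.le_succ k))) h1
    have h3 : g.coeff k • q k ∈ Submodule.span R (q '' Set.Iio (k + 1)) :=
      Submodule.smul_mem _ _ (Submodule.subset_span ⟨k, Nat.lt_succ_self k, rfl⟩)
    simpa using add_mem h2 h3

-- The basis is q i = ∏_{j<i} (X - d j), for which X * q i = d i • q i + q (i + 1). Matching the
-- second coefficients of q n and p makes q n - p of degree below n - 1, so the last diagonal entry
-- is exactly d (n - 1).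
open Polynomial in
lemma isIdempotentAddNilpotent_root_of_nextCoeff {p : (ZMod 2)[X]} (hp : p.Monic)
    (hn : 0 < p.natDegree) (P : ℕ → Prop) (d : ℕ → ZMod 2) (hP : ∀ i, P i → ¬ P (i + 1))
    (hP3 : ∀ i, P i ∨ P (i + 1) ∨ P (i + 2)) (hPlast : ∀ i, i + 2 = p.natDegree → P i)
    (hPn : ¬ P (p.natDegree - 1))
    (hd1 : ∀ i, P i → d (i + 1) = 1) (hd0 : ∀ i, P i → d i = 0)
    (hsum : ∑ i ∈ Finset.range p.natDegree, -d i = p.nextCoeff) :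
    IsIdempotentAddNilpotent (AddMonoidHom.mulLeft (AdjoinRoot.root p)) := by
  set n := p.natDegree with hn_def
  let q : ℕ → (ZMod 2)[X] := fun i => ∏ j ∈ Finset.range i, (X - C (d j))
  have hq : ∀ i, (q i).Monic := fun i => monic_prod_of_monic _ _ fun j _ => monic_X_sub_C _
  have hqdeg : ∀ i, (q i).natDegree = i := fun i => by
    simp [q, natDegree_prod_of_monic _ _ fun j _ => monic_X_sub_C (d j)]
  have hqs : ∀ i, q (i + 1) = q i * (X - C (d i)) := fun i => Finset.prod_range_succ _ _
  have hqnext : (q n).nextCoeff = p.nextCoeff := by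
    rw [← hsum, Polynomial.Monic.nextCoeff_prod _ _ fun j _ => monic_X_sub_C (d j)]
    simp
  let π : (ZMod 2)[X] →ₗ[ZMod 2] AdjoinRoot p := (AdjoinRoot.mkₐ p).toLinearMap
  have hπ : ∀ g, π g = AdjoinRoot.mk p g := fun g => rfl
  let v : ℕ → AdjoinRoot p := fun i => π (q i)
  have himg : ∀ (k : ℕ) (g : (ZMod 2)[X]), g.degree < (k : WithBot ℕ) →
      π g ∈ Submodule.span (ZMod 2) (v '' Set.Iio k) := by
    intro k g hg
    have := Submodule.mem_map_of_mem (f := π) (mem_span_of_degree_lt q hq hqdeg k g hg)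
    rwa [Submodule.map_span, ← Set.image_comp] at this
  have hspan : ⊤ ≤ Submodule.span (ZMod 2) (Set.range fun i : Fin n => v i) := by
    rintro x -
    obtain ⟨g, rfl⟩ := AdjoinRoot.mk_surjective x
    have h1 : AdjoinRoot.mk p g = π (g %ₘ p) := by
      rw [hπ, AdjoinRoot.mk_eq_mk]
      exact ⟨g /ₘ p, by rw [sub_eq_iff_eq_add, add_comm]; exact (modByMonic_add_div g p).symm⟩
    have h2 : (g %ₘ p).degree < (n : ℕ) := by
      rw [hn_def, ← degree_eq_natDegree hp.ne_zero]
      exact degree_modByMonic_lt _ hp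
    rw [h1]
    refine Submodule.span_mono ?_ (himg n _ h2)
    rintro _ ⟨j, hj, rfl⟩
    exact ⟨⟨j, hj⟩, rfl⟩
  have hfin : Fintype.card (Fin n) = Module.finrank (ZMod 2) (AdjoinRoot p) := by
    rw [(AdjoinRoot.powerBasis' hp).finrank, AdjoinRoot.powerBasis'_dim, Fintype.card_fin]
  let b := basisOfTopLeSpanOfCardEqFinrank _ hspan hfin
  have hmul : ∀ i, AdjoinRoot.root p * v i = d i • v i + v (i + 1) := by
    intro i
    have : X * q i = d i • q i + q (i + 1) := by
      rw [hqs, smul_eq_C_mul]; ring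
    calc AdjoinRoot.root p * v i = π (X * q i) := (map_mul (AdjoinRoot.mk p) X (q i)).symm
      _ = _ := by rw [this, map_add, map_smul]
  refine isIdempotentAddNilpotent_of_basis (LinearMap.mulLeft (ZMod 2) (AdjoinRoot.root p)) hn v b
    (fun i => by simp [b]) P d hP hP3 hPlast hPn hd1 hd0 (fun i _ => hmul i) ?_
  rw [LinearMap.mulLeft_apply, hmul, add_sub_cancel_left, Nat.sub_add_cancel hn]
  have h1 : v n = π (q n - p) := by
    rw [map_sub, hπ p, AdjoinRoot.mk_self, sub_zero]
  rw [h1]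
  apply himg
  rw [degree_lt_iff_coeff_zero]
  intro m hm
  rw [coeff_sub, sub_eq_zero]
  have hqn := hqdeg n
  rcases hm.eq_or_lt with rfl | hm
  · rw [nextCoeff_of_natDegree_pos (by omega), nextCoeff_of_natDegree_pos hn, hqn] at hqnext
    exact hqnext
  · rcases (show n ≤ m by omega).eq_or_lt with rfl | hm
    · have h2 := (hq n).coeff_natDegree
      rw [hqn] at h2
      rw [h2]; exact hp.coeff_natDegree.symm
    · rw [coeff_eq_zero_of_natDegree_lt (by omega), coeff_eq_zero_of_natDegree_lt hm]

-- When 0 is not in `P`, the value d 0 is unconstrained and can absorb the prescribed trace.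
open Polynomial in
lemma isIdempotentAddNilpotent_root_of_not_zero {p : (ZMod 2)[X]} (hp : p.Monic)
    (hn : 0 < p.natDegree) (P : ℕ → Prop) (hP : ∀ i, P i → ¬ P (i + 1))
    (hP3 : ∀ i, P i ∨ P (i + 1) ∨ P (i + 2)) (hPlast : ∀ i, i + 2 = p.natDegree → P i)
    (hPn : ¬ P (p.natDegree - 1)) (hP0 : ¬ P 0) :
    IsIdempotentAddNilpotent (AddMonoidHom.mulLeft (AdjoinRoot.root p)) := by
  classical
  obtain ⟨n, hn'⟩ : ∃ n, p.natDegree = n + 1 := ⟨p.natDegree - 1, by omega⟩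
  let d : ℕ → ZMod 2 := fun i => Nat.casesOn i
    (-p.nextCoeff - ∑ i ∈ Finset.range n, (if P i then 1 else 0)) fun j => if P j then 1 else 0
  refine isIdempotentAddNilpotent_root_of_nextCoeff hp hn P d hP hP3 hPlast hPn ?_ ?_ ?_
  · intro i hi
    simp [d, hi]
  · rintro (_ | i) hi
    · exact absurd hi hP0
    · have : ¬ P i := fun h => hP i h hi
      simp [d, this]
  · rw [hn', Finset.sum_range_succ']
    have h0 : d 0 = -p.nextCoeff - ∑ i ∈ Finset.range n, (if P i then 1 else 0) := rfl
    have hsucc : ∀ i, d (i + 1) = if P i then 1 else 0 := fun i => rfl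
    simp only [h0, hsucc, Finset.sum_neg_distrib]
    abel

open Polynomial in
lemma isIdempotentAddNilpotent_root {p : (ZMod 2)[X]} (hp : p.Monic) :
    IsIdempotentAddNilpotent (AddMonoidHom.mulLeft (AdjoinRoot.root p)) := by
  rcases Nat.even_or_odd p.natDegree with he | ho
  · rcases lt_or_ge 2 p.natDegree with h2 | h2
    -- Index 0 is dropped to keep d 0 free; the initial gap 0, 1 is still short enough.
    · refine isIdempotentAddNilpotent_root_of_not_zero hp (by omega) (fun i => 2 ≤ i ∧ Even i)
        ?_ ?_ ?_ ?_ ?_ <;> grind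
    · have h02 : p.natDegree = 0 ∨ p.natDegree = 2 := by grind
      rcases h02 with h0 | h2
      · have := hp.natDegree_eq_zero.1 h0
        subst this
        have h1 : (1 : AdjoinRoot (1 : (ZMod 2)[X])) = 0 := AdjoinRoot.mk_self
        have : Subsingleton (AdjoinRoot (1 : (ZMod 2)[X])) := subsingleton_of_zero_eq_one h1.symm
        exact ⟨0, 0, zero_mul _, zero_pow four_ne_zero,
          AddMonoidHom.ext fun _ => Subsingleton.elim _ _⟩
      -- In degree 2, `P` must contain 0, which forces d = (0, 1) and trace 1. The trace-zero cases
      -- X ^ 2 and X ^ 2 + 1 = (X + 1) ^ 2 are nilpotent and unipotent.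
      · have hcoeff : ∀ x : ZMod 2, x = 0 ∨ x = 1 := by decide
        have hpX : p = X ^ 2 + C (p.coeff 1) * X + C (p.coeff 0) := by
          have h := p.as_sum_range_C_mul_X_pow
          have h3 : p.coeff 2 = 1 := by
            have h4 := hp.coeff_natDegree
            rwa [h2] at h4
          rw [h2] at h
          simp only [Finset.sum_range_succ, Finset.range_zero, Finset.sum_empty, h3] at h
          rw [h]
          simp
          ring
        have hroot : AdjoinRoot.mk p (X ^ 2 + C (p.coeff 1) * X + C (p.coeff 0)) = 0 := by
          rw [← hpX]; exact AdjoinRoot.mk_self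
        have htwo : ∀ x : AdjoinRoot p, x + x = 0 := fun x => by
          rw [← two_smul (ZMod 2), show (2 : ZMod 2) = 0 from rfl, zero_smul]
        rcases hcoeff (p.coeff 1) with h1 | h1
        · rw [h1] at hroot
          rcases hcoeff (p.coeff 0) with h0 | h0
          · refine ⟨0, AddMonoidHom.mulLeft (AdjoinRoot.root p), zero_mul _, ?_, (zero_add _).symm⟩
            rw [h0] at hroot
            simp at hroot
            ext x
            change AdjoinRoot.root p * (AdjoinRoot.root p * (AdjoinRoot.root p *
              (AdjoinRoot.root p * x))) = 0
            linear_combination (AdjoinRoot.root p ^ 2 * x) * hroot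
          · refine ⟨1, AddMonoidHom.mulLeft (AdjoinRoot.root p + 1), one_mul _, ?_, ?_⟩
            · rw [h0] at hroot
              simp at hroot
              ext x
              change (AdjoinRoot.root p + 1) * ((AdjoinRoot.root p + 1) * ((AdjoinRoot.root p + 1) *
                ((AdjoinRoot.root p + 1) * x))) = 0
              have h4 : (AdjoinRoot.root p + 1) ^ 2 = 0 := by
                linear_combination hroot + htwo (AdjoinRoot.root p)
              linear_combination ((AdjoinRoot.root p + 1) ^ 2 * x) * h4
            · ext x
              change AdjoinRoot.root p * x = x + (AdjoinRoot.root p + 1) * x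
              linear_combination -htwo x
        · refine isIdempotentAddNilpotent_root_of_nextCoeff hp (by omega) (fun i => Even i)
            (fun i => if Even i then 0 else 1) ?_ ?_ ?_ ?_ ?_ ?_ ?_
          · grind
          · grind
          · grind
          · rw [h2]; decide
          · grind
          · grind
          · rw [nextCoeff_of_natDegree_pos (by omega), h2, h1]
            decide
  · exact isIdempotentAddNilpotent_root_of_not_zero hp ho.pos (fun i => Odd i)
      (by grind) (by grind) (by grind) (by grind) (by decide)

/-! ### From cyclic modules to matrices -/

lemma IsIdempotentAddNilpotent.of_addEquiv {M M' : Type*} [AddCommGroup M] [AddCommGroup M']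
    {f : AddMonoid.End M} {g : AddMonoid.End M'} (e : M ≃+ M') (h : ∀ m, e (f m) = g (e m))
    (hg : IsIdempotentAddNilpotent g) : IsIdempotentAddNilpotent f := by
  obtain ⟨E, N, hE, hN, rfl⟩ := hg
  let c : AddMonoid.End M' → AddMonoid.End M := fun T =>
    (e.symm.toAddMonoidHom.comp T).comp e.toAddMonoidHom
  have hc : ∀ T m, c T m = e.symm (T (e m)) := fun _ _ => rfl
  refine ⟨c E, c N, ?_, ?_, ?_⟩
  · ext m
    have := DFunLike.congr_fun hE (e m)
    change E (E (e m)) = E (e m) at this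
    change c E (c E m) = c E m
    simp only [hc, e.apply_symm_apply, this]
  · ext m
    have := DFunLike.congr_fun hN (e m)
    change N (N (N (N (e m)))) = 0 at this
    change c N (c N (c N (c N m))) = 0
    simp only [hc, e.apply_symm_apply, this, map_zero]
  · ext m
    change f m = c E m + c N m
    rw [hc, hc, ← map_add, e.eq_symm_apply, h]
    rfl

open DirectSum in
lemma IsIdempotentAddNilpotent.directSum_map {ι : Type*} {M : ι → Type*}
    [∀ i, AddCommGroup (M i)] (f : ∀ i, AddMonoid.End (M i))
    (hf : ∀ i, IsIdempotentAddNilpotent (f i)) :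
    IsIdempotentAddNilpotent (DirectSum.map f : AddMonoid.End (⨁ i, M i)) := by
  choose E N hE hN hEN using hf
  refine ⟨DirectSum.map E, DirectSum.map N, ?_, ?_, ?_⟩
  · refine AddMonoidHom.ext fun x => DFinsupp.ext fun i => ?_
    change DirectSum.map E (DirectSum.map E x) i = DirectSum.map E x i
    exact DFunLike.congr_fun (hE i) (x i)
  · refine AddMonoidHom.ext fun x => DFinsupp.ext fun i => ?_
    change DirectSum.map N (DirectSum.map N (DirectSum.map N (DirectSum.map N x))) i = 0
    exact DFunLike.congr_fun (hN i) (x i)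
  · refine AddMonoidHom.ext fun x => DFinsupp.ext fun i => ?_
    change DirectSum.map f x i = DirectSum.map E x i + DirectSum.map N x i
    exact DFunLike.congr_fun (hEN i) (x i)

open Polynomial DirectSum in
lemma isIdempotentAddNilpotent_toAddMonoidHom {V : Type} [AddCommGroup V] [Module (ZMod 2) V]
    [Module.Finite (ZMod 2) V] (f : Module.End (ZMod 2) V) :
    IsIdempotentAddNilpotent (f.toAddMonoidHom : AddMonoid.End V) := by
  have htors : Module.IsTorsion (ZMod 2)[X] (Module.AEval' f) := by
    intro x
    refine ⟨⟨minpoly (ZMod 2) f, mem_nonZeroDivisors_of_ne_zero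
      (minpoly.ne_zero (Algebra.IsIntegral.isIntegral f))⟩, ?_⟩
    apply (Module.AEval'.of f).symm.injective
    change (Module.AEval.of (ZMod 2) V f).symm (minpoly (ZMod 2) f • x) = _
    rw [Module.AEval.of_symm_smul, minpoly.aeval, zero_smul, map_zero]
  obtain ⟨ι, _, p, hp, e, ⟨φ⟩⟩ := Module.equiv_directSum_of_isTorsion htors
  let g : ∀ i, AddMonoid.End ((ZMod 2)[X] ⧸ Submodule.span (ZMod 2)[X] {p i ^ e i}) :=
    fun i => DistribSMul.toAddMonoidHom _ (X : (ZMod 2)[X])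
  refine IsIdempotentAddNilpotent.of_addEquiv
    ((Module.AEval'.of f).toAddEquiv.trans φ.toAddEquiv)
    (g := DirectSum.map g) ?_ ?_
  · intro m
    change φ (Module.AEval'.of f (f m)) = _
    rw [← Module.AEval'.X_smul_of, map_smul]
    refine DFinsupp.ext fun i => ?_
    exact (DirectSum.map_apply g i _).symm
  · refine IsIdempotentAddNilpotent.directSum_map g fun i => ?_
    have hmonic : (p i ^ e i).Monic := by
      have h : (p i ^ e i).leadingCoeff ≠ 0 :=
        leadingCoeff_ne_zero.2 (pow_ne_zero _ (hp i).ne_zero)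
      have h2 : ∀ x : ZMod 2, x ≠ 0 → x = 1 := by decide
      exact h2 _ h
    refine IsIdempotentAddNilpotent.of_addEquiv
      (AddEquiv.refl (AdjoinRoot (p i ^ e i))) (fun m => ?_) (isIdempotentAddNilpotent_root hmonic)
    obtain ⟨g, rfl⟩ := AdjoinRoot.mk_surjective m
    rfl

/-- Every square matrix over `𝔽₂` is the sum of an idempotent and a matrix whose fourth power is
zero. -/
lemma Matrix.exists_isIdempotentElem_add_nilpotent {n : Type} [Fintype n] [DecidableEq n]
    (A : Matrix n n (ZMod 2)) :
    ∃ E N : Matrix n n (ZMod 2), IsIdempotentElem E ∧ N ^ 4 = 0 ∧ A = E + N := by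
  obtain ⟨E, N, hE, hN, hEN⟩ := isIdempotentAddNilpotent_toAddMonoidHom (Matrix.toLin' A)
  -- Additive maps between 𝔽₂-spaces are automatically linear, so working with additive
  -- endomorphisms loses nothing.
  let E' : Module.End (ZMod 2) (n → ZMod 2) := AddMonoidHom.toZModLinearMap 2 E
  let N' : Module.End (ZMod 2) (n → ZMod 2) := AddMonoidHom.toZModLinearMap 2 N
  have hE' : E' * E' = E' := LinearMap.ext fun x => DFunLike.congr_fun hE x
  have hN' : N' ^ 4 = 0 := LinearMap.ext fun x => DFunLike.congr_fun hN x
  have hA : Matrix.toLin' A = E' + N' := LinearMap.ext fun x => DFunLike.congr_fun hEN x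
  let t := LinearMap.toMatrixAlgEquiv' (R := ZMod 2) (n := n)
  refine ⟨t E', t N', ?_, ?_, ?_⟩
  · rw [IsIdempotentElem, ← map_mul, hE']
  · rw [← map_pow, hN', map_zero]
  · rw [← map_add, ← hA]
    exact (LinearMap.toMatrixAlgEquiv'_toLinAlgEquiv' A).symm

lemma Matrix.isAlmostTorsionClean_four (n : ℕ) :
    IsAlmostTorsionClean (Matrix (Fin n) (Fin n) (ZMod 2)) 4 := by
  refine ⟨by norm_num, fun A => ?_⟩
  obtain ⟨E, N, hE, hN, rfl⟩ := A.exists_isIdempotentElem_add_nilpotent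
  have htwo : ∀ B : Matrix (Fin n) (Fin n) (ZMod 2), B + B = 0 := fun B => by
    rw [← two_smul (ZMod 2), show (2 : ZMod 2) = 0 from rfl, zero_smul]
  have hU : (1 + N) ^ 4 = 1 := by
    have : (1 + N) ^ 4 = 1 + N ^ 4 + ((N + N) + (N + N)) + ((N ^ 2 + N ^ 2) + (N ^ 2 + N ^ 2)
        + (N ^ 2 + N ^ 2)) + ((N ^ 3 + N ^ 3) + (N ^ 3 + N ^ 3)) := by noncomm_ring
    rw [this, hN]
    simp [htwo]
  refine ⟨Units.ofPowEqOne (1 + N) 4 hU four_ne_zero, 1 - E, ?_, hE.one_sub, ?_⟩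
  · exact Units.pow_ofPowEqOne hU four_ne_zero
  · rw [Units.val_ofPowEqOne]
    have : (1 + N) + (1 - E) = E + N + ((1 + 1) - (E + E)) := by abel
    rw [this, htwo, htwo]
    simp

/-! ### Exponents below 4 fail when n = 4 + 8k -/

/-- Since 4 + 8k = 4(2k + 1), the diagonal embedding repeats A an odd number of times, which
preserves traces mod 2. -/
lemma Matrix.exists_ringHom_trace_eq (k : ℕ) :
    ∃ φ : Matrix (Fin 4) (Fin 4) (ZMod 2) →+* Matrix (Fin (4 + 8 * k)) (Fin (4 + 8 * k)) (ZMod 2),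
      ∀ A, (φ A).trace = A.trace := by
  let e : Fin 4 × Fin (2 * k + 1) ≃ Fin (4 + 8 * k) :=
    finProdFinEquiv.trans (finCongr (by ring))
  refine ⟨(Matrix.reindexAlgEquiv (ZMod 2) (ZMod 2) e).toRingEquiv.toRingHom.comp
    ((Matrix.blockDiagonalRingHom (Fin 4) (Fin (2 * k + 1)) (ZMod 2)).comp
      (Pi.constRingHom (Fin (2 * k + 1)) _)), fun A => ?_⟩
  change ((Matrix.blockDiagonal fun _ => A).submatrix e.symm e.symm).trace = _
  have h1 : ((Matrix.blockDiagonal fun _ => A).submatrix e.symm e.symm).trace =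
      (Matrix.blockDiagonal fun _ : Fin (2 * k + 1) => A).trace :=
    e.symm.sum_comp fun i => Matrix.blockDiagonal (fun _ => A) i i
  have h2 : (2 : ZMod 2) = 0 := rfl
  rw [h1, Matrix.trace_blockDiagonal]
  simp [h2]


/-- If A = U + E, then A ^ 2 + A = 1 + U + UE + EU commutes with E. As A is a polynomial in A ^ 2 +
A, it commutes with E too. Then E = A ^ 2 - 1, and idempotency with A ^ 5 = 1 forces A = 1, which
the quintic cyclotomic relation excludes. -/
lemma ne_add_of_sq_eq_one {R : Type*} [Ring R] [Nontrivial R] [CharP R 2] {A E U : R}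
    (hA : A ^ 4 + A ^ 3 + A ^ 2 + A + 1 = 0) (hE : IsIdempotentElem E) (hU : U ^ 2 = 1) :
    A ≠ U + E := by
  intro hAE
  have hE' : E * E = E := hE
  have htwo : ∀ B : R, B + B = 0 := CharTwo.add_self_eq_zero
  have h5 : A ^ 5 = 1 := by
    have : A ^ 5 - 1 = (A - 1) * (A ^ 4 + A ^ 3 + A ^ 2 + A + 1) := by noncomm_ring
    rw [hA, mul_zero] at this
    exact sub_eq_zero.1 this
  have hC : A = (A ^ 2 + A) ^ 4 + (A ^ 2 + A) ^ 3 + 1 := by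
    -- Integer division by A ^ 5 - 1; the remainder has even coefficients and is written as B + B.
    have : (A ^ 2 + A) ^ 4 + (A ^ 2 + A) ^ 3 + 1 - A = (A ^ 5 - 1) * (7 • 1 + 7 * A + 4 * A ^ 2 + A ^ 3)
        + ((2 * A ^ 4 + A ^ 3 + 2 * A ^ 2 + 3 * A + 4 • 1)
          + (2 * A ^ 4 + A ^ 3 + 2 * A ^ 2 + 3 * A + 4 • 1)) := by noncomm_ring
    rw [h5, sub_self, zero_mul, htwo, add_zero] at this
    exact (sub_eq_zero.1 this).symm
  have hEC : Commute E (A ^ 2 + A) := by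
    have h1 : E * (A ^ 2 + A) = E * U ^ 2 + E * U * E + (E * E) * U + (E * E) * E + E * U
        + E * E := by rw [hAE]; noncomm_ring
    have h2 : (A ^ 2 + A) * E = U ^ 2 * E + E * U * E + U * (E * E) + (E * E) * E + U * E
        + E * E := by rw [hAE]; noncomm_ring
    rw [Commute, SemiconjBy, h1, h2, hU, hE', hE']
    calc _ = E + E * U * E + (E * U + E * U) + (E + E) := by noncomm_ring
      _ = E + E * U * E + (U * E + U * E) + (E + E) := by rw [htwo (E * U), htwo (U * E)]
      _ = _ := by noncomm_ring
  have hEA : E * A = A * E := by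
    have : Commute E ((A ^ 2 + A) ^ 4 + (A ^ 2 + A) ^ 3 + 1) :=
      ((hEC.pow_right 4).add_right (hEC.pow_right 3)).add_right (Commute.one_right E)
    rwa [← hC] at this
  have hEq : E = A ^ 2 - 1 := by
    have h1 : U = A - E := by rw [hAE]; abel
    have h2 : U ^ 2 = A ^ 2 + E * E - (A * E + E * A) := by rw [h1]; noncomm_ring
    rw [hU, hE', hEA, htwo, sub_zero] at h2
    rw [h2]
    have : E = A ^ 2 - (A ^ 2 + E) + (E + E) := by abel
    rwa [htwo, add_zero] at this
  have h42 : A ^ 4 = A ^ 2 := by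
    have h1 : (A ^ 2 - 1) * (A ^ 2 - 1) = A ^ 4 + 1 - (A ^ 2 + A ^ 2) := by noncomm_ring
    rw [← hEq, hE', htwo, sub_zero, hEq, CharTwo.sub_eq_add] at h1
    exact (add_right_cancel h1).symm
  have h2 : A ^ 2 = 1 := by
    calc A ^ 2 = A ^ 5 * A ^ 2 := by rw [h5, one_mul]
      _ = A ^ 4 * A ^ 3 := by rw [← pow_add, ← pow_add]
      _ = A ^ 5 := by rw [h42, ← pow_add]
      _ = 1 := h5
  have h4 : A ^ 4 = 1 := by rw [h42, h2]
  have h1 : A = 1 := by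
    rw [pow_succ, h4, one_mul] at h5
    exact h5
  rw [h1] at hA
  simp [htwo] at hA

/-- Put aᵢ = tr(A ^ i * E). The traces of U ^ 3, U ^ 3 * A and U ^ 3 * (A * E) give 1 + a₀ + a₁ + a₂
= 0, a₃ = 0 and a₀ + a₁ + a₂ + a₃ = 0, which sum to 1 = 0. -/
lemma Matrix.ne_add_of_cube_eq_one {n : Type*} [Fintype n] [DecidableEq n]
    {A E U : Matrix n n (ZMod 2)} (hA : A ^ 4 = A + 1)
    (hn : (1 : Matrix n n (ZMod 2)).trace = 0) (hA1 : A.trace = 0) (hA3 : (A ^ 3).trace = 1)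
    (hE : IsIdempotentElem E) (hU : U ^ 3 = 1) : A ≠ U + E := by
  intro hAE
  have hE' : E * E = E := hE
  have hU' : U = A + E := by
    have : A + E = U + (E + E) := by rw [hAE]; abel
    rw [this, ← two_smul (ZMod 2), show (2 : ZMod 2) = 0 from rfl, zero_smul, add_zero]
  have rot : ∀ X Y : Matrix n n (ZMod 2), (X * Y).trace = (Y * X).trace := Matrix.trace_mul_comm
  -- Frobenius: tr(M ^ 2) = (tr M) ^ 2 over 𝔽₂, and squaring fixes 𝔽₂.
  have hfrob : (A * E * (A * E)).trace = (A * E).trace := by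
    rw [← sq, ZMod.trace_pow_card]
    generalize (A * E).trace = x
    decide +revert
  have hA4 : (A ^ 4).trace = 0 := by rw [hA, Matrix.trace_add, hA1, hn, add_zero]
  have hA4E : (A ^ 4 * E).trace = (A * E).trace + E.trace := by
    rw [hA, add_mul, one_mul, Matrix.trace_add]
  have e1 : U ^ 3 = A ^ 3 + A ^ 2 * E + A * E * A + E * A ^ 2 + A * (E * E) + E * A * E
      + E * E * A + E * E * E := by rw [hU']; noncomm_ring
  have e2 : U ^ 3 * A = A ^ 4 + A ^ 2 * E * A + A * E * A * A + E * A ^ 3 + A * (E * E) * A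
      + E * A * E * A + E * E * A * A + E * E * E * A := by rw [e1]; noncomm_ring
  have e3 : U ^ 3 * (A * E) = A ^ 4 * E + A ^ 2 * E * (A * E) + A * E * (A ^ 2 * E)
      + E * (A ^ 3 * E) + A * (E * E) * (A * E) + E * (A * E * (A * E)) + E * E * A * (A * E)
      + E * E * E * (A * E) := by rw [e1]; noncomm_ring
  rw [hE'] at e1 e2 e3
  rw [hE'] at e1 e2 e3
  replace e1 := congrArg Matrix.trace e1
  replace e2 := congrArg Matrix.trace e2
  replace e3 := congrArg Matrix.trace e3
  have w1 : (A * E * A).trace = (A ^ 2 * E).trace := by rw [rot]; congr 1; noncomm_ring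
  have w2 : (E * A * E).trace = (A * E).trace := by rw [rot, ← mul_assoc, hE', rot]
  have w3 : (A ^ 2 * E * A).trace = (A ^ 3 * E).trace := by rw [rot]; congr 1; noncomm_ring
  have w4 : (A * E * A * A).trace = (A ^ 3 * E).trace := by
    rw [mul_assoc, rot]; congr 1; noncomm_ring
  have w5 : (E * A * E * A).trace = (A * E).trace := by
    rw [← hfrob, show E * A * E * A = E * (A * E * A) by noncomm_ring, rot]
    congr 1; noncomm_ring
  have w6 : (E * A * A).trace = (A ^ 2 * E).trace := by rw [mul_assoc, rot, sq]
  have w7 : (E * (A ^ 3 * E)).trace = (A ^ 3 * E).trace := by rw [rot, mul_assoc, hE']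
  have w8 : (E * (A * E * (A * E))).trace = (A * E).trace := by
    rw [rot, show A * E * (A * E) * E = A * E * (A * (E * E)) by noncomm_ring, hE', hfrob]
  have w9 : (E * A * (A * E)).trace = (A ^ 2 * E).trace := by
    rw [mul_assoc, rot, show A * (A * E) * E = A ^ 2 * (E * E) by noncomm_ring, hE']
  have w10 : (E * (A * E)).trace = (A * E).trace := by rw [rot, mul_assoc, hE']
  simp only [hU, one_mul, Matrix.trace_add, w1, w2, w3, w4, w5, w6, w7, w8, w9, w10, hfrob, hA1,
    hA3, hA4, hA4E, hn, rot (A * E) (A ^ 2 * E), rot E A, rot E (A ^ 2), rot E (A ^ 3)] at e1 e2 e3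
  -- Here b = tr(A ^ 2 * E * (A * E)) occurs twice and cancels.
  have key : ∀ a₀ a₁ a₂ a₃ b : ZMod 2, 0 = 1 + a₂ + a₂ + a₂ + a₁ + a₁ + a₁ + a₀ →
      0 = 0 + a₃ + a₃ + a₃ + a₂ + a₁ + a₂ + a₁ →
      a₁ = a₁ + a₀ + b + b + a₃ + a₁ + a₁ + a₂ + a₁ → False := by decide
  exact key _ _ _ _ _ e1 e2 e3

lemma Matrix.not_isAlmostTorsionClean_two (k : ℕ) :
    ¬ IsAlmostTorsionClean (Matrix (Fin (4 + 8 * k)) (Fin (4 + 8 * k)) (ZMod 2)) 2 := by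
  rintro ⟨-, h⟩
  obtain ⟨φ, -⟩ := Matrix.exists_ringHom_trace_eq k
  let A : Matrix (Fin 4) (Fin 4) (ZMod 2) := !![0, 0, 0, 1; 1, 0, 0, 1; 0, 1, 0, 1; 0, 0, 1, 1]
  have hA : A ^ 4 + A ^ 3 + A ^ 2 + A + 1 = 0 := by decide
  obtain ⟨u, e, hu, he, h⟩ := h (φ A)
  have : Nonempty (Fin (4 + 8 * k)) := ⟨⟨0, by omega⟩⟩
  refine ne_add_of_sq_eq_one ?_ he ?_ h
  · simpa using congrArg φ hA
  · rw [← Units.val_pow_eq_pow_val, hu, Units.val_one]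

lemma Matrix.not_isAlmostTorsionClean_three (k : ℕ) :
    ¬ IsAlmostTorsionClean (Matrix (Fin (4 + 8 * k)) (Fin (4 + 8 * k)) (ZMod 2)) 3 := by
  rintro ⟨-, h⟩
  obtain ⟨φ, hφ⟩ := Matrix.exists_ringHom_trace_eq k
  let A : Matrix (Fin 4) (Fin 4) (ZMod 2) := !![0, 0, 0, 1; 1, 0, 0, 1; 0, 1, 0, 0; 0, 0, 1, 0]
  have hA : A ^ 4 = A + 1 := by decide
  obtain ⟨u, e, hu, he, h⟩ := h (φ A)
  refine Matrix.ne_add_of_cube_eq_one ?_ ?_ ?_ ?_ he ?_ h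
  · simpa using congrArg φ hA
  · rw [← map_one φ, hφ]; decide
  · rw [hφ]; decide
  · rw [← map_pow, hφ]; decide
  · rw [← Units.val_pow_eq_pow_val, hu, Units.val_one]

theorem theorem2p1 (n : ℕ) :
    (∃ m ∈ ({2, 3, 4} : Set ℕ), IsAlmostTorsionClean (Matrix (Fin n) (Fin n) (ZMod 2)) m) ∧
    IsAlmostTorsionClean (Matrix (Fin n) (Fin n) (ZMod 2)) 4 ∧
    ((∃ k : ℕ, n = 4 + 8 * k) →
      IsTorsionClean (Matrix (Fin n) (Fin n) (ZMod 2)) 4) := by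
  have h4 := Matrix.isAlmostTorsionClean_four n
  refine ⟨⟨4, by simp, h4⟩, h4, ?_⟩
  rintro ⟨k, rfl⟩
  refine ⟨h4, fun m hm => ?_⟩
  by_contra! hlt
  obtain ⟨hpos, hm'⟩ := id hm
  interval_cases m
  -- Exponent 1 implies exponent 2.
  · refine Matrix.not_isAlmostTorsionClean_two k ⟨by norm_num, fun r => ?_⟩
    obtain ⟨u, e, hu, he, h⟩ := hm' r
    exact ⟨u, e, by rw [pow_one] at hu; rw [hu, one_pow], he, h⟩
  · exact Matrix.not_isAlmostTorsionClean_two k hm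
  · exact Matrix.not_isAlmostTorsionClean_three k hm
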